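/- Let $M$ and $N$ be smooth closed manifolds (compact, without boundary) of dimensions $m$ and $n$, let $c\in C^1(M\times N;\mathbf R)$, and let $\mu$, $\nu$ be Borel probability measures on $M$ and $N$, both absolutely continuous with respect to Lebesgue measure (null sets being defined in charts). Let $\Pi(\mu,\nu)$ be the set of non-negative Borel measures on $M\times N$ with marginals $\mu$ and $\nu$, and let $\Pi_0$ be the set of all minimizers of $\gamma\mapsto\int_{M\times N} c\,d\gamma$ on $\Pi(\mu,\nu)$. A set $S\subset M\times N$ is called $c$-cyclically monotone if $\sum_{i=1}^I[c(x_{i+1},y_i)-c(x_i,y_i)]\ge 0$ for all $I\ge 1$ and $(x_1,y_1),\dots,(x_I,y_I)\in S$, where $x_{I+1}=x_1$. An $L$-chain in $S$ ($L\ge 1$) is an ordered family $((x_1,y_1),\dots,(x_L,y_L))\in S^L$ such that $\{(x_1,y_1),\dots,(x_L,y_L)\}$ is $c$-cyclically monotone and, for every $l=1,\dots,L-1$, either $$x_l=x_{l+1},\quad y_l\ne y_{l+1}=y_{\min\{L,l+2\}},\quad \frac{\partial c}{\partial x}(x_l,y_l)=\frac{\partial c}{\partial x}(x_l,y_{l+1}),$$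 or $$y_l=y_{l+1},\quad x_l\ne x_{l+1}=x_{\min\{L,l+2\}},\quad \frac{\partial c}{\partial y}(x_l,y_l)=\frac{\partial c}{\partial y}(x_{l+1},y_l).$$ Let $E_0\subset M\times N$ be a $\sigma$-compact set with $\gamma(E_0)=0$ for all $\gamma\in\Pi_0$, and let $E_\infty$ be the set of points which occur in $k$-chains in $(M\times N)\setminus E_0$ for arbitrarily large $k$. Let $\pi^M,\pi^N$ be the projections of $M\times N$ onto $M$ and $N$; that a set is null for a measure means that it is contained in a Borel set of measure zero. If $\mu(\pi^M(E_\infty))=0$ or $\nu(\pi^N(E_\infty))=0$, then $\gamma(E_\infty)=0$ for every $\gamma\in\Pi_0$, and $\Pi_0$ is a singleton, i.e. there is exactly one optimal plan. -/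

import Mathlib

open scoped Manifold ContDiff
open MeasureTheory

namespace OptTransport

variable {M N : Type*}

/-- `c`-cyclical monotonicity of a set `S ⊆ M × N`: for every `I ≥ 1` and all points
`p 1, …, p I` of `S`, written `p i = (x i, y i)` and with `x (I + 1) = x 1`, one has
`∑_{i=1}^I (c (x (i+1), y i) - c (x i, y i)) ≥ 0`. -/
def CCyclicallyMonotone (c : M × N → ℝ) (S : Set (M × N)) : Prop :=
  ∀ I : ℕ, 1 ≤ I → ∀ (x : ℕ → M) (y : ℕ → N),
    (∀ i ∈ Finset.Icc 1 I, (x i, y i) ∈ S) → x (I + 1) = x 1 →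
      0 ≤ ∑ i ∈ Finset.Icc 1 I, (c (x (i + 1), y i) - c (x i, y i))

section Manifolds

variable {m n : ℕ}
  [TopologicalSpace M] [ChartedSpace (EuclideanSpace ℝ (Fin m)) M]
  [TopologicalSpace N] [ChartedSpace (EuclideanSpace ℝ (Fin n)) N]

/-- The partial differential `∂c/∂x (x, y)`, a covector on `T_x M`. -/
noncomputable def partialX (c : M × N → ℝ) (x : M) (y : N) :
    TangentSpace (𝓡 m) x →L[ℝ] ℝ :=
  mfderiv (𝓡 m) 𝓘(ℝ, ℝ) (fun x' : M => c (x', y)) x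

/-- The partial differential `∂c/∂y (x, y)`, a covector on `T_y N`. -/
noncomputable def partialY (c : M × N → ℝ) (x : M) (y : N) :
    TangentSpace (𝓡 n) y →L[ℝ] ℝ :=
  mfderiv (𝓡 n) 𝓘(ℝ, ℝ) (fun y' : N => c (x, y')) y

variable (m n) in
/-- `((x 1, y 1), …, (x L, y L))` is a chain in `S` of length `L ≥ 1` for the cost `c`.
The values of `x` and `y` at indices outside `{1, …, L}` play no role. -/
structure IsAlternantChain (c : M × N → ℝ) (S : Set (M × N)) (L : ℕ)
    (x : ℕ → M) (y : ℕ → N) : Prop where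
  one_le : 1 ≤ L
  mem : ∀ l ∈ Set.Icc 1 L, (x l, y l) ∈ S
  cyclicallyMonotone : CCyclicallyMonotone c ((fun l => (x l, y l)) '' Set.Icc 1 L)
  step : ∀ l, 1 ≤ l → l < L →
    (x l = x (l + 1) ∧ y l ≠ y (l + 1) ∧ y (l + 1) = y (min L (l + 2)) ∧
      partialX (m := m) c (x l) (y l) = partialX (m := m) c (x l) (y (l + 1))) ∨
    (y l = y (l + 1) ∧ x l ≠ x (l + 1) ∧ x (l + 1) = x (min L (l + 2)) ∧
      partialY (n := n) c (x l) (y l) = partialY (n := n) c (x (l + 1)) (y l))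

variable (m n) in
/-- `E_∞`: the set of points which occur in `k`-chains in `S` for arbitrarily large `k`. -/
def chainLimitSet (c : M × N → ℝ) (S : Set (M × N)) : Set (M × N) :=
  {z | ∀ K : ℕ, ∃ k, K ≤ k ∧ ∃ (x : ℕ → M) (y : ℕ → N),
    IsAlternantChain m n c S k x y ∧ ∃ l ∈ Set.Icc 1 k, (x l, y l) = z}

variable (m) in
/-- A measure on an `m`-dimensional manifold is absolutely continuous with respect to Lebesgue
measure: it vanishes on every Borel set whose image in each chart is Lebesgue negligible. -/
def AbsContLebesgue [MeasurableSpace M] (μ : Measure M) : Prop :=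
  ∀ s : Set M, MeasurableSet s →
    (∀ e ∈ atlas (EuclideanSpace ℝ (Fin m)) M, volume (e '' (s ∩ e.source)) = 0) → μ s = 0

end Manifolds

variable [MeasurableSpace M] [MeasurableSpace N]

/-- `Π(μ, ν)`: the measures on `M × N` with marginals `μ` and `ν`. -/
def transportPlans (μ : Measure M) (ν : Measure N) : Set (Measure (M × N)) :=
  {γ | γ.map Prod.fst = μ ∧ γ.map Prod.snd = ν}

/-- The minimizers of the Kantorovitch problem `γ ↦ ∫ c dγ` on `Π(μ, ν)`. -/
def optimalPlans (c : M × N → ℝ) (μ : Measure M) (ν : Measure N) : Set (Measure (M × N)) :=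
  {γ | γ ∈ transportPlans μ ν ∧
    ∀ γ' ∈ transportPlans μ ν, ∫ z, c z ∂γ ≤ ∫ z, c z ∂γ'}

end OptTransport

/-! The midpoint of two optimal plans is optimal, so it suffices to find a set that carries the
midpoint, hence both plans, and on which a plan is determined by its marginals. The support of the
midpoint is `c`-cyclically monotone (`cCyclicallyMonotone_support`), hence lies in the contact set
of potentials `φ + ψ ≤ c` (`CCyclicallyMonotone.exists_potentials`). These inherit the Lipschitz
bounds of `c` and are differentiable almost everywhere by Rademacher's theorem. At a contact point
over points of differentiability, `∂c/∂x = dφ` and `∂c/∂y = dψ`. Since `dφ` depends on `x` alone and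
`dψ` on `y` alone, alternating horizontal and vertical moves through such points form a chain
(`isAlternantChain_of_path`).

View the carrying set `T` as a bipartite graph with edges `(x, y)`. The mass on edges with a leaf is
forced by the marginals, so such edges can be stripped, round after round
(`restrict_compl_branch_eq`). An edge that survives every round starts alternating paths of every
length, so it lies in `E_∞`, which is null and was removed from `T`. Nothing survives, and the plans
agree. -/

namespace OptTransport

/-! ### Stripping the points that are alone in their fibre -/

section Branch

variable {Z X : Type*}

/-- The points of `T` whose fibre under `f` contains another point of `T`. -/
def branch (f : Z → X) (T : Set Z) : Set Z := {z ∈ T | ∃ w ∈ T, f w = f z ∧ w ≠ z}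

lemma branch_subset (f : Z → X) (T : Set Z) : branch f T ⊆ T := fun _ hz => hz.1

lemma isSigmaCompact_iUnion_of_isCompact {ι : Type*} [Countable ι] [TopologicalSpace Z]
    {s : ι → Set Z} (hs : ∀ i, IsCompact (s i)) : IsSigmaCompact (⋃ i, s i) := by
  rcases isEmpty_or_nonempty ι with h | h
  · rw [Set.iUnion_of_empty]
    exact isSigmaCompact_empty
  · obtain ⟨g, hg⟩ := exists_surjective_nat ι
    exact ⟨fun n => s (g n), fun n => hs _, hg.iUnion_comp s⟩

/-- Lying in the same fibre is a closed condition, and being distinct is a countable union of closed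
conditions `dist ≥ 1 / (k + 1)`; what remains is a countable union of projections of compact sets.
Working with `σ`-compact sets thus keeps every round of stripping Borel. -/
lemma isSigmaCompact_branch [TopologicalSpace Z] [TopologicalSpace.MetrizableSpace Z]
    [TopologicalSpace X] [T2Space X] {f : Z → X} (hf : Continuous f) {T : Set Z}
    (hT : IsSigmaCompact T) : IsSigmaCompact (branch f T) := by
  let := TopologicalSpace.metrizableSpaceMetric Z
  obtain ⟨K, hK, rfl⟩ := hT
  have key : branch f (⋃ n, K n) = ⋃ i : ℕ × ℕ × ℕ, Prod.fst '' ((K i.1 ×ˢ K i.2.1) ∩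
      {p : Z × Z | f p.2 = f p.1 ∧ (1 : ℝ) / (i.2.2 + 1) ≤ dist p.1 p.2}) := by
    ext z
    simp only [branch, Set.mem_iUnion, Set.mem_ofPred_eq, Set.mem_image, Set.mem_inter_iff,
      Set.mem_prod, Prod.exists, exists_and_right, exists_eq_right]
    constructor
    · rintro ⟨⟨i, hi⟩, w, ⟨j, hj⟩, hfw, hne⟩
      obtain ⟨k, hk⟩ := exists_nat_one_div_lt (dist_pos.2 hne.symm)
      exact ⟨i, j, k, w, ⟨hi, hj⟩, hfw, hk.le⟩
    · rintro ⟨i, j, k, w, ⟨hi, hj⟩, hfw, hk⟩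
      refine ⟨⟨i, hi⟩, w, ⟨j, hj⟩, hfw, ?_⟩
      rintro rfl
      rw [dist_self] at hk
      have : (0 : ℝ) < 1 / (k + 1) := by positivity
      linarith
  rw [key]
  refine isSigmaCompact_iUnion_of_isCompact fun i => ?_
  refine IsCompact.image (((hK _).prod (hK _)).inter_right ?_) continuous_fst
  exact (isClosed_eq (hf.comp continuous_snd) (hf.comp continuous_fst)).inter
    (isClosed_le continuous_const (continuous_fst.dist continuous_snd))

lemma measurableSet_of_isSigmaCompact [TopologicalSpace Z] [T2Space Z] [MeasurableSpace Z]
    [OpensMeasurableSpace Z] {T : Set Z} (hT : IsSigmaCompact T) : MeasurableSet T := by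
  obtain ⟨K, hK, rfl⟩ := hT
  exact MeasurableSet.iUnion fun n => (hK n).measurableSet

/-- Two finite measures that have the same image under `f` and agree off `T` also agree
off `branch f T`, because `f` separates the points of `T \ branch f T` from the rest of `T`. -/
lemma restrict_compl_branch_eq [MeasurableSpace Z] [StandardBorelSpace Z] [MeasurableSpace X]
    [MeasurableSpace.CountablySeparated X] {f : Z → X} (hf : Measurable f) {T : Set Z}
    (hT : MeasurableSet T) (hT' : MeasurableSet (branch f T)) {γ₁ γ₂ : Measure Z}
    [IsFiniteMeasure γ₁] [IsFiniteMeasure γ₂]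
    (hmap : γ₁.map f = γ₂.map f) (h : γ₁.restrict Tᶜ = γ₂.restrict Tᶜ) :
    γ₁.restrict (branch f T)ᶜ = γ₂.restrict (branch f T)ᶜ := by
  have sep : ∀ b ∈ T \ branch f T, ∀ z ∈ T, f z = f b → z = b := by
    intro b hb z hz hzb
    by_contra hne
    exact hb.2 ⟨hb.1, z, hz, hzb, hne⟩
  have off : ∀ B, MeasurableSet B → γ₁ (B \ T) = γ₂ (B \ T) := fun B hB => by
    have := congrArg (fun m : Measure Z => m B) h
    simpa only [Measure.restrict_apply hB, ← Set.sdiff_eq] using this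
  have on : ∀ B, MeasurableSet B → B ⊆ T \ branch f T → γ₁ B = γ₂ B := by
    intro B hB hBT
    -- `f` is injective on `B`, so Lusin–Souslin applies.
    have hP : MeasurableSet (f '' B) := hB.image_of_measurable_injOn hf
      fun a ha b hb hab => sep b (hBT hb) a (hBT ha).1 hab
    have hQ : MeasurableSet (f ⁻¹' (f '' B)) := hf hP
    -- A fibre through `B` meets `T` only in `B`. The common image measure of `f '' B` is therefore
    -- the mass of `B` plus a mass off `T`, where the two measures agree; finiteness allows
    -- cancellation.
    have hsplit : f ⁻¹' (f '' B) = B ∪ (f ⁻¹' (f '' B) \ T) := by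
      ext z
      constructor
      · rintro ⟨b, hb, hbz⟩
        by_cases hz : z ∈ T
        · left
          rwa [sep b (hBT hb) z hz hbz.symm]
        · exact Or.inr ⟨⟨b, hb, hbz⟩, hz⟩
      · rintro (hz | hz)
        · exact ⟨z, hz, rfl⟩
        · exact hz.1
    have hdisj : Disjoint B (f ⁻¹' (f '' B) \ T) :=
      Set.disjoint_left.2 fun z hz hz' => hz'.2 (hBT hz).1
    have hval : ∀ γ : Measure Z, γ.map f (f '' B) = γ B + γ (f ⁻¹' (f '' B) \ T) := by
      intro γ
      rw [Measure.map_apply hf hP, ← measure_union hdisj (hQ.diff hT), ← hsplit]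
    have e := hval γ₁
    rw [hmap, hval γ₂, off _ hQ] at e
    exact ((ENNReal.add_left_inj (measure_ne_top _ _)).1 e).symm
  ext B hB
  rw [Measure.restrict_apply hB, Measure.restrict_apply hB]
  have hsplit : B ∩ (branch f T)ᶜ = (B ∩ (T \ branch f T)) ∪ (B \ T) := by
    ext z
    have := @branch_subset _ _ f T z
    simp only [Set.mem_inter_iff, Set.mem_compl_iff, Set.mem_union, Set.mem_sdiff]
    tauto
  have hdisj : Disjoint (B ∩ (T \ branch f T)) (B \ T) :=
    Set.disjoint_left.2 fun z hz hz' => hz'.2 hz.2.1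
  rw [hsplit, measure_union hdisj (hB.diff hT), measure_union hdisj (hB.diff hT), off B hB,
    on _ (hB.inter (hT.diff hT')) Set.inter_subset_right]

end Branch

/-! ### Leaf removal in bipartite graphs and alternating paths -/

section Prune

variable {M N : Type*}

/-- Removal of the edges of the bipartite graph `T` that have an end of degree one: first those
with a leaf in `M`, then those with a leaf in `N`. -/
def prune (T : Set (M × N)) : Set (M × N) :=
  branch Prod.snd (branch Prod.fst T)

lemma prune_subset (T : Set (M × N)) : prune T ⊆ T :=
  (branch_subset _ _).trans (branch_subset _ _)

/-- Two distinct points share their first (if `b`) or their second (if not `b`) coordinate. -/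
def Adjacent (b : Bool) (z w : M × N) : Prop :=
  w ≠ z ∧ (bif b then w.1 = z.1 else w.2 = z.2)

lemma exists_adjacent_of_mem_prune {T : Set (M × N)} {z : M × N} (hz : z ∈ prune T) (b : Bool) :
    ∃ w ∈ T, Adjacent b z w := by
  cases b with
  | false =>
    obtain ⟨_, w, hw, h1, h2⟩ := hz
    exact ⟨w, hw.1, h2, h1⟩
  | true =>
    obtain ⟨⟨_, w, hw, h1, h2⟩, _⟩ := hz
    exact ⟨w, hw, h2, h1⟩

/-- Each round pays for one move: a survivor of round `k + 1` has neighbours of both kinds among the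
survivors of round `k`. Parity encodes the alternation, so the rest of the path starts with `!b`. -/
lemma exists_path_of_mem_iterate_prune {T : Set (M × N)} (k : ℕ) :
    ∀ z ∈ prune^[k] T, ∀ b : Bool, ∃ p : ℕ → M × N, p 0 = z ∧ (∀ l ≤ k, p l ∈ T) ∧
      ∀ l < k, Adjacent (xor b (l.bodd)) (p l) (p (l + 1)) := by
  induction k with
  | zero => exact fun z hz b => ⟨fun _ => z, rfl, fun _ _ => hz, fun l hl => by omega⟩
  | succ k ih =>
    intro z hz b
    rw [Function.iterate_succ_apply'] at hz
    have hzT : z ∈ T := by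
      obtain ⟨p, h0, hp, -⟩ := ih z (prune_subset _ hz) b
      exact h0 ▸ hp 0 (Nat.zero_le _)
    obtain ⟨w, hw, hzw⟩ := exists_adjacent_of_mem_prune hz b
    obtain ⟨p, h0, hp, hadj⟩ := ih w hw (!b)
    refine ⟨fun l => Nat.casesOn l z p, rfl, ?_, ?_⟩
    · rintro (_ | l) hl
      · exact hzT
      · exact hp l (by omega)
    · rintro (_ | l) hl
      · simpa [h0] using hzw
      · have := hadj l (by omega)
        simpa [Nat.bodd_succ] using this

/-- Two finite measures with the same marginals that are concentrated on a `σ`-compact set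
without arbitrarily long alternating paths coincide. -/
lemma measure_eq_of_iInter_iterate_prune_eq_empty
    [TopologicalSpace M] [TopologicalSpace.MetrizableSpace M] [MeasurableSpace M]
    [BorelSpace M] [StandardBorelSpace M] [SecondCountableTopology M]
    [TopologicalSpace N] [TopologicalSpace.MetrizableSpace N] [MeasurableSpace N]
    [BorelSpace N] [StandardBorelSpace N]
    {T : Set (M × N)} (hT : IsSigmaCompact T) (hT0 : ⋂ k, prune^[k] T = ∅)
    {γ₁ γ₂ : Measure (M × N)} [IsFiniteMeasure γ₁] [IsFiniteMeasure γ₂]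
    (h1 : γ₁ Tᶜ = 0) (h2 : γ₂ Tᶜ = 0)
    (hfst : γ₁.map Prod.fst = γ₂.map Prod.fst) (hsnd : γ₁.map Prod.snd = γ₂.map Prod.snd) :
    γ₁ = γ₂ := by
  have key : ∀ k, IsSigmaCompact (prune^[k] T) ∧
      γ₁.restrict (prune^[k] T)ᶜ = γ₂.restrict (prune^[k] T)ᶜ := by
    intro k
    induction k with
    | zero =>
      refine ⟨hT, ?_⟩
      simp only [Function.iterate_zero, id]
      rw [Measure.restrict_eq_zero.2 h1, Measure.restrict_eq_zero.2 h2]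
    | succ k ih =>
      obtain ⟨hc, he⟩ := ih
      rw [Function.iterate_succ_apply']
      have hc1 := isSigmaCompact_branch continuous_fst hc
      have hc2 := isSigmaCompact_branch continuous_snd hc1
      exact ⟨hc2, restrict_compl_branch_eq measurable_snd (measurableSet_of_isSigmaCompact hc1)
        (measurableSet_of_isSigmaCompact hc2) hsnd
        (restrict_compl_branch_eq measurable_fst (measurableSet_of_isSigmaCompact hc)
          (measurableSet_of_isSigmaCompact hc1) hfst he)⟩
  -- The measures agree off every iterate, and these complements cover the whole space.
  have := Measure.restrict_iUnion_congr.2 fun k => (key k).2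
  rwa [← Set.compl_iInter, hT0, Set.compl_empty, Measure.restrict_univ,
    Measure.restrict_univ] at this

end Prune

/-! ### Kantorovich potentials of a cyclically monotone set -/

section Potentials

variable {M N : Type*}

/-- The values of the sums `∑ (c (xᵢ₊₁, yᵢ) - c (xᵢ, yᵢ))` along the finite sequences in `Γ`
which lead from `p₀` to a given point. -/
inductive ReachableCost (c : M × N → ℝ) (Γ : Set (M × N)) (p₀ : M × N) : M × N → ℝ → Prop
  | base : ReachableCost c Γ p₀ p₀ 0
  | step {p q : M × N} {s : ℝ} (h : ReachableCost c Γ p₀ p s) (hq : q ∈ Γ) :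
      ReachableCost c Γ p₀ q (s + c (q.1, p.2) - c p)

lemma ReachableCost.exists_seq {c : M × N → ℝ} {Γ : Set (M × N)} {p₀ p : M × N} {s : ℝ}
    (hp₀ : p₀ ∈ Γ) (h : ReachableCost c Γ p₀ p s) :
    ∃ (J : ℕ) (x : ℕ → M) (y : ℕ → N), (∀ i ∈ Finset.Icc 1 (J + 1), (x i, y i) ∈ Γ) ∧
      x 1 = p₀.1 ∧ (x (J + 1), y (J + 1)) = p ∧
      s = ∑ i ∈ Finset.Icc 1 J, (c (x (i + 1), y i) - c (x i, y i)) := by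
  induction h with
  | base => exact ⟨0, fun _ => p₀.1, fun _ => p₀.2, fun _ _ => hp₀, rfl, rfl, by simp⟩
  | @step p q s h hq ih =>
    obtain ⟨J, x, y, hmem, hx1, hp, hs⟩ := ih
    refine ⟨J + 1, fun i => if i ≤ J + 1 then x i else q.1,
      fun i => if i ≤ J + 1 then y i else q.2, ?_, ?_, ?_, ?_⟩
    · intro i hi
      by_cases h' : i ≤ J + 1
      · simpa [h'] using hmem i (by simp at hi ⊢; omega)
      · simpa [h'] using hq
    · simpa using hx1
    · simp
    · rw [Finset.sum_Icc_succ_top (by omega)]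
      have : ∑ i ∈ Finset.Icc 1 J, (c (if i + 1 ≤ J + 1 then x (i + 1) else q.1,
            if i ≤ J + 1 then y i else q.2) -
          c (if i ≤ J + 1 then x i else q.1, if i ≤ J + 1 then y i else q.2)) = s := by
        rw [hs]
        refine Finset.sum_congr rfl fun i hi => ?_
        have hi' := Finset.mem_Icc.1 hi
        rw [if_pos (by omega), if_pos (by omega), if_pos (by omega)]
      rw [this, ← hp]
      simp
      ring

/-- A path that returns to `p₀` is a cycle in `Γ`. This is the only use of cyclical monotonicity in
building the potentials. -/
lemma ReachableCost.nonneg {c : M × N → ℝ} {Γ : Set (M × N)} (hΓ : CCyclicallyMonotone c Γ)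
    {p₀ : M × N} {s : ℝ} (hp₀ : p₀ ∈ Γ) (h : ReachableCost c Γ p₀ p₀ s) : 0 ≤ s := by
  obtain ⟨J, x, y, hmem, hx1, hp, rfl⟩ := h.exists_seq hp₀
  rcases Nat.eq_zero_or_pos J with rfl | hJ
  · simp
  · refine hΓ J hJ x y (fun i hi => hmem i ?_) ?_
    · simp at hi ⊢
      omega
    · rw [hx1, ← hp]

/-- A `c`-cyclically monotone set has Kantorovich potentials, which inherit the moduli of
continuity of `c`. -/
lemma CCyclicallyMonotone.exists_potentials {c : M × N → ℝ} {C : ℝ} (hC : ∀ z, |c z| ≤ C)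
    {Γ : Set (M × N)} (hΓ : CCyclicallyMonotone c Γ) (hne : Γ.Nonempty) :
    ∃ (φ : M → ℝ) (ψ : N → ℝ), (∀ z, φ z.1 + ψ z.2 ≤ c z) ∧ (∀ z ∈ Γ, φ z.1 + ψ z.2 = c z) ∧
      (∀ x x' K, (∀ y, c (x, y) ≤ c (x', y) + K) → φ x ≤ φ x' + K) ∧
      (∀ y y' K, (∀ x, c (x, y) ≤ c (x, y') + K) → ψ y ≤ ψ y' + K) := by
  obtain ⟨p₀, hp₀⟩ := hne
  have hC' : ∀ z, -C ≤ c z ∧ c z ≤ C := fun z => abs_le.1 (hC z)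
  let B : M → Set ℝ := fun x => {r | ∃ p s, ReachableCost c Γ p₀ p s ∧ r = s + c (x, p.2) - c p}
  have hBne : ∀ x, (B x).Nonempty := fun x => ⟨_, p₀, 0, .base, rfl⟩
  have hBbdd : ∀ x, BddBelow (B x) := by
    refine fun x => ⟨-2 * C, ?_⟩
    rintro r ⟨p, s, h, rfl⟩
    -- Closing the path at `p₀` bounds `s - c p` below by `-c (p₀.1, p.2) ≥ -C`; the last hop costs
    -- at least `-C` more.
    have h1 := (h.step hp₀).nonneg hΓ hp₀
    linarith [hC' (x, p.2), hC' (p₀.1, p.2)]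
  let φ : M → ℝ := fun x => sInf (B x)
  have hφle : ∀ x p s, ReachableCost c Γ p₀ p s → φ x ≤ s + c (x, p.2) - c p :=
    fun x p s h => csInf_le (hBbdd x) ⟨p, s, h, rfl⟩
  have hφC : ∀ x, φ x ≤ 2 * C := fun x => by
    linarith [hφle x p₀ 0 .base, hC' (x, p₀.2), hC' p₀]
  -- Every path can be prolonged through `z` before its last hop to `x`.
  have hφΓ : ∀ x, ∀ z ∈ Γ, φ x ≤ φ z.1 + c (x, z.2) - c z := by
    intro x z hz
    suffices φ x - c (x, z.2) + c z ≤ φ z.1 by linarith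
    refine le_csInf (hBne _) ?_
    rintro r ⟨p, s, h, rfl⟩
    linarith [hφle x z _ (h.step hz)]
  -- The `c`-transform of `φ`; on `Γ`, `hφΓ` shows that the infimum is attained at `z.1`.
  let ψ : N → ℝ := fun y => sInf (Set.range fun x => c (x, y) - φ x)
  have hψbdd : ∀ y, BddBelow (Set.range fun x => c (x, y) - φ x) := by
    refine fun y => ⟨-3 * C, ?_⟩
    rintro _ ⟨x, rfl⟩
    dsimp only
    linarith [hφC x, hC' (x, y)]
  have hψne : ∀ y, (Set.range fun x => c (x, y) - φ x).Nonempty := fun y => ⟨_, p₀.1, rfl⟩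
  have hψle : ∀ x y, ψ y ≤ c (x, y) - φ x := fun x y => csInf_le (hψbdd y) ⟨x, rfl⟩
  refine ⟨φ, ψ, fun z => by linarith [hψle z.1 z.2], fun z hz => ?_, fun x x' K hK => ?_,
    fun y y' K hK => ?_⟩
  · refine le_antisymm (by linarith [hψle z.1 z.2]) ?_
    suffices c z - φ z.1 ≤ ψ z.2 by linarith
    refine le_csInf (hψne _) ?_
    rintro _ ⟨x, rfl⟩
    dsimp only
    linarith [hφΓ x z hz]
  · suffices φ x - K ≤ φ x' by linarith
    refine le_csInf (hBne _) ?_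
    rintro r ⟨p, s, h, rfl⟩
    linarith [hφle x p s h, hK p.2]
  · suffices ψ y - K ≤ ψ y' by linarith
    refine le_csInf (hψne _) ?_
    rintro _ ⟨x, rfl⟩
    dsimp only
    linarith [hψle x y, hK x]

end Potentials

/-! ### Cyclical monotonicity of the support of an optimal plan -/

section Support

variable {M N : Type*}

lemma integrable_of_continuous_of_compactSpace {Z : Type*} [TopologicalSpace Z] [CompactSpace Z]
    [TopologicalSpace.MetrizableSpace Z]
    [MeasurableSpace Z] [OpensMeasurableSpace Z] {c : Z → ℝ}
    (hc : Continuous c) (γ : Measure Z) [IsFiniteMeasure γ] : Integrable c γ := by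
  rw [← integrableOn_univ]
  exact hc.continuousOn.integrableOn_compact isCompact_univ

lemma isProbabilityMeasure_of_mem_transportPlans [MeasurableSpace M] [MeasurableSpace N]
    {μ : Measure M} [IsProbabilityMeasure μ] {ν : Measure N} {γ : Measure (M × N)}
    (hγ : γ ∈ transportPlans μ ν) : IsProbabilityMeasure γ := by
  refine ⟨?_⟩
  have := congrArg (fun m : Measure M => m Set.univ) hγ.1
  simpa [Measure.map_apply measurable_fst] using this

/-- A cycle is the permutation `finRotate`. The exchange argument below works for any permutation,
since it only reindexes a sum. -/
lemma cCyclicallyMonotone_of_perm {c : M × N → ℝ} {S : Set (M × N)}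
    (h : ∀ (n : ℕ) (σ : Equiv.Perm (Fin (n + 1))) (p : Fin (n + 1) → M × N), (∀ i, p i ∈ S) →
      0 ≤ ∑ i, (c ((p (σ i)).1, (p i).2) - c (p i))) : CCyclicallyMonotone c S := by
  intro I hI x y hmem hx
  obtain ⟨n, rfl⟩ : ∃ n, I = n + 1 := ⟨I - 1, by omega⟩
  have := h n (finRotate (n + 1)) (fun i => (x (i + 1), y (i + 1)))
    (fun i => hmem _ (by have := i.2; simp; omega))
  convert this using 1
  rw [← Finset.sum_bij (s := Finset.range (n + 1))
    (f := fun i => c (x (i + 2), y (i + 1)) - c (x (i + 1), y (i + 1)))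
    (i := fun i _ => i + 1)]
  · rw [Finset.sum_range]
    refine Finset.sum_congr rfl fun i _ => ?_
    congr 3
    rcases Fin.eq_castSucc_or_eq_last i with ⟨j, rfl⟩ | rfl
    · rw [finRotate_of_lt (by simp)]
    · rw [finRotate_last]
      simpa using hx
  · intro i hi
    simp at hi ⊢
    omega
  · intro i _ j _ hij
    omega
  · intro i hi
    simp at hi
    exact ⟨i - 1, by simp; omega, by omega⟩
  · intro i _
    rfl

variable [TopologicalSpace M] [TopologicalSpace.MetrizableSpace M] [CompactSpace M]
  [MeasurableSpace M] [BorelSpace M]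
  [TopologicalSpace N] [TopologicalSpace.MetrizableSpace N] [CompactSpace N]
  [MeasurableSpace N] [BorelSpace N]

open ProbabilityTheory in
/-- The support of an optimal plan is `c`-cyclically monotone: otherwise, permuting the first
marginals of small pieces of the plan lowers the cost. -/
lemma cCyclicallyMonotone_support [SecondCountableTopology M] {c : M × N → ℝ} (hc : Continuous c)
    {μ : Measure M} [IsProbabilityMeasure μ] {ν : Measure N} {γ : Measure (M × N)}
    (hγ : γ ∈ optimalPlans c μ ν) : CCyclicallyMonotone c γ.support := by
  have := isProbabilityMeasure_of_mem_transportPlans hγ.1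
  refine cCyclicallyMonotone_of_perm fun n σ p hp => ?_
  by_contra! hneg
  let := TopologicalSpace.metrizableSpaceMetric M
  let := TopologicalSpace.metrizableSpaceMetric N
  obtain ⟨δ, hδ0, hδ⟩ : ∃ δ : ℝ, 0 < δ ∧
      ∑ i, (c ((p (σ i)).1, (p i).2) - c (p i)) + (n + 1) * (2 * δ) < 0 := by
    -- The errors `± δ` of the `n + 1` old and new terms then use up half of the gap.
    refine ⟨-(∑ i, (c ((p (σ i)).1, (p i).2) - c (p i))) / (4 * (n + 1)), ?_, ?_⟩
    · exact div_pos (by linarith) (by positivity)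
    · field_simp
      linarith
  obtain ⟨ε, hε, hcε⟩ := Metric.uniformContinuous_iff.1
    (CompactSpace.uniformContinuous_of_continuous hc) δ hδ0
  have hcε' : ∀ z w : M × N, z.1 ∈ Metric.ball w.1 ε → z.2 ∈ Metric.ball w.2 ε →
      |c z - c w| < δ := fun z w h1 h2 => hcε (max_lt h1 h2)
  let U : Fin (n + 1) → Set M := fun i => Metric.ball (p i).1 ε
  let V : Fin (n + 1) → Set N := fun i => Metric.ball (p i).2 ε
  have hU : ∀ i, MeasurableSet (U i) := fun i => measurableSet_ball
  have hV : ∀ i, MeasurableSet (V i) := fun i => measurableSet_ball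
  have hW : ∀ i, MeasurableSet (U i ×ˢ V i) := fun i => (hU i).prod (hV i)
  have hpos : ∀ i, γ (U i ×ˢ V i) ≠ 0 := fun i =>
    ((Measure.mem_support_iff_forall (p i)).1 (hp i) _
      (prod_mem_nhds (Metric.ball_mem_nhds _ hε) (Metric.ball_mem_nhds _ hε))).ne'
  let κ : Fin (n + 1) → Measure (M × N) := fun i => γ[|U i ×ˢ V i]
  have hκ : ∀ i, IsProbabilityMeasure (κ i) := fun i => cond_isProbabilityMeasure (hpos i)
  let α : Fin (n + 1) → Measure M := fun i => (κ i).map Prod.fst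
  let β : Fin (n + 1) → Measure N := fun i => (κ i).map Prod.snd
  have hα : ∀ i, IsProbabilityMeasure (α i) := fun i =>
    Measure.isProbabilityMeasure_map measurable_fst.aemeasurable
  have hβ : ∀ i, IsProbabilityMeasure (β i) := fun i =>
    Measure.isProbabilityMeasure_map measurable_snd.aemeasurable
  have hκmem : ∀ i, ∀ᵐ z ∂κ i, z ∈ U i ×ˢ V i := fun i => ae_cond_mem (hW i)
  have hαmem : ∀ i, ∀ᵐ x ∂α i, x ∈ U i := fun i => by
    refine (ae_map_iff measurable_fst.aemeasurable (hU i)).2 ?_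
    filter_upwards [hκmem i] with z hz using hz.1
  have hβmem : ∀ i, ∀ᵐ y ∂β i, y ∈ V i := fun i => by
    refine (ae_map_iff measurable_snd.aemeasurable (hV i)).2 ?_
    filter_upwards [hκmem i] with z hz using hz.2
  have hint : ∀ (m : Measure (M × N)) [IsFiniteMeasure m], Integrable c m :=
    fun m _ => integrable_of_continuous_of_compactSpace hc m
  have hlow : ∀ i, c (p i) - δ ≤ ∫ z, c z ∂κ i := by
    intro i
    have : ∫ _, (c (p i) - δ) ∂κ i ≤ ∫ z, c z ∂κ i := by
      refine integral_mono_ae (integrable_const _) (hint _) ?_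
      filter_upwards [hκmem i] with z hz
      linarith [abs_lt.1 (hcε' z (p i) hz.1 hz.2)]
    simpa using this
  have hup : ∀ i, ∫ z, c z ∂((α (σ i)).prod (β i)) ≤ c ((p (σ i)).1, (p i).2) + δ := by
    intro i
    have : ∫ z, c z ∂((α (σ i)).prod (β i)) ≤
        ∫ _, (c ((p (σ i)).1, (p i).2) + δ) ∂((α (σ i)).prod (β i)) := by
      refine integral_mono_ae (hint _) (integrable_const _) ?_
      filter_upwards [Measure.ae_prod_mem_iff_ae_ae_mem ((hU (σ i)).prod (hV i)) |>.2
        (by filter_upwards [hαmem (σ i)] with x hx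
            filter_upwards [hβmem i] with y hy using ⟨hx, hy⟩)] with z hz
      linarith [abs_lt.1 (hcε' z ((p (σ i)).1, (p i).2) hz.1 hz.2)]
    simpa using this
  -- Each `κ i` is at most `(γ (U i ×ˢ V i))⁻¹ • γ`, so the factor `T⁻¹` makes the removed part `D`
  -- at most `γ`. Its replacement `P` has the same marginals, as `σ` only permutes the `α i`.
  let T : ENNReal := ∑ i, (γ (U i ×ˢ V i))⁻¹
  have hTtop : T ≠ ⊤ := ENNReal.sum_ne_top.2 fun i _ => ENNReal.inv_ne_top.2 (hpos i)
  have hT0 : T ≠ 0 := by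
    intro h
    have := (Finset.sum_eq_zero_iff.1 h) 0 (Finset.mem_univ _)
    exact measure_ne_top _ _ (ENNReal.inv_eq_zero.1 this)
  have htop : T⁻¹ ≠ ⊤ := ENNReal.inv_ne_top.2 hT0
  let D : Measure (M × N) := T⁻¹ • ∑ i, κ i
  let P : Measure (M × N) := T⁻¹ • ∑ i, (α (σ i)).prod (β i)
  have hDγ : D ≤ γ := by
    have h1 : ∑ i, κ i ≤ T • γ := by
      rw [Finset.sum_smul]
      refine Finset.sum_le_sum fun i _ => ?_
      refine Measure.le_iff.2 fun s _ => ?_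
      simp only [κ, ProbabilityTheory.cond, Measure.smul_apply, smul_eq_mul]
      gcongr
      exact Measure.restrict_le_self
    calc D ≤ T⁻¹ • T • γ := by
          refine Measure.le_iff.2 fun s _ => ?_
          simp only [D, Measure.smul_apply, smul_eq_mul]
          gcongr
          simpa using h1 s
      _ = γ := by rw [smul_smul, ENNReal.inv_mul_cancel hT0 hTtop, one_smul]
  have : IsFiniteMeasure D := isFiniteMeasure_of_le γ hDγ
  have : IsFiniteMeasure P := Measure.smul_finite _ htop
  have hγD : γ - D + D = γ := Measure.sub_add_cancel_of_le hDγ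
  have hfst : P.map Prod.fst = D.map Prod.fst := by
    simp only [P, D, Measure.map_smul]
    rw [Measure.map_finset_sum' measurable_fst.aemeasurable,
      Measure.map_finset_sum' measurable_fst.aemeasurable]
    rw [← Equiv.sum_comp σ fun i => (κ i).map Prod.fst]
    simp [Measure.map_fst_prod, α]
  have hsnd : P.map Prod.snd = D.map Prod.snd := by
    simp only [P, D, Measure.map_smul]
    rw [Measure.map_finset_sum' measurable_snd.aemeasurable,
      Measure.map_finset_sum' measurable_snd.aemeasurable]
    simp [Measure.map_snd_prod, β]
  have hplan : γ - D + P ∈ transportPlans μ ν := by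
    constructor
    · rw [Measure.map_add _ _ measurable_fst, hfst, ← Measure.map_add _ _ measurable_fst, hγD]
      exact hγ.1.1
    · rw [Measure.map_add _ _ measurable_snd, hsnd, ← Measure.map_add _ _ measurable_snd, hγD]
      exact hγ.1.2
  have hle := hγ.2 _ hplan
  have e1 : ∫ z, c z ∂γ = ∫ z, c z ∂(γ - D) + ∫ z, c z ∂D := by
    rw [← integral_add_measure (hint _) (hint _), hγD]
  rw [e1, integral_add_measure (hint _) (hint _)] at hle
  have e2 : ∫ z, c z ∂D = T⁻¹.toReal * ∑ i, ∫ z, c z ∂κ i := by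
    rw [integral_smul_measure, integral_finsetSum_measure fun i _ => hint _, smul_eq_mul]
  have e3 : ∫ z, c z ∂P = T⁻¹.toReal * ∑ i, ∫ z, c z ∂((α (σ i)).prod (β i)) := by
    rw [integral_smul_measure, integral_finsetSum_measure fun i _ => hint _, smul_eq_mul]
  have hTpos : 0 < T⁻¹.toReal := ENNReal.toReal_pos (ENNReal.inv_ne_zero.2 hTtop) htop
  rw [e2, e3, add_le_add_iff_left] at hle
  have hle' := le_of_mul_le_mul_left hle hTpos
  have h3 : ∑ i, (c (p i) - δ) ≤ ∑ i, (c ((p (σ i)).1, (p i).2) + δ) :=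
    (Finset.sum_le_sum fun i _ => hlow i).trans (hle'.trans (Finset.sum_le_sum fun i _ => hup i))
  rw [Finset.sum_sub_distrib, Finset.sum_add_distrib] at h3
  rw [Finset.sum_sub_distrib] at hδ
  simp only [Finset.sum_const, Finset.card_univ, Fintype.card_fin, nsmul_eq_mul] at h3
  push_cast at h3
  linarith

end Support

/-! ### Differentiability of the potentials -/

section Differentiability

open Topology

variable {m n : ℕ} {M N : Type*}
  [TopologicalSpace M] [ChartedSpace (EuclideanSpace ℝ (Fin m)) M]
  [TopologicalSpace N] [ChartedSpace (EuclideanSpace ℝ (Fin n)) N]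

lemma mdifferentiableAt_iff_comp_symm [IsManifold (𝓡 m) 1 M] {φ : M → ℝ}
    {e : OpenPartialHomeomorph M (EuclideanSpace ℝ (Fin m))}
    (he : e ∈ atlas (EuclideanSpace ℝ (Fin m)) M) {x : M} (hx : x ∈ e.source) :
    MDifferentiableAt (𝓡 m) 𝓘(ℝ, ℝ) φ x ↔ DifferentiableAt ℝ (φ ∘ e.symm) (e x) := by
  rw [← mdifferentiableWithinAt_univ, mdifferentiableWithinAt_iff_source_of_mem_maximalAtlas
    (IsManifold.subset_maximalAtlas he) hx]
  simp [mdifferentiableWithinAt_univ, mdifferentiableAt_iff_differentiableAt]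

/-- `AbsContLebesgue` only tests Borel sets. Finitely many charts cover `M`, and the set of
differentiability points of an arbitrary real function on Euclidean space is Borel. -/
lemma measurableSet_mdifferentiableAt [IsManifold (𝓡 m) 1 M] [CompactSpace M]
    [MeasurableSpace M] [BorelSpace M] (φ : M → ℝ) :
    MeasurableSet {x | MDifferentiableAt (𝓡 m) 𝓘(ℝ, ℝ) φ x} := by
  obtain ⟨F, hF⟩ := CompactSpace.elim_nhds_subcover
    (fun x : M => (chartAt (EuclideanSpace ℝ (Fin m)) x).source)
    fun x => chart_source_mem_nhds _ x
  have key : {x | MDifferentiableAt (𝓡 m) 𝓘(ℝ, ℝ) φ x} = ⋃ x₀ ∈ F,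
      (Subtype.val : (chartAt (EuclideanSpace ℝ (Fin m)) x₀).source → M) ''
        ((fun x => chartAt (EuclideanSpace ℝ (Fin m)) x₀ x.1) ⁻¹'
          {z | DifferentiableAt ℝ (φ ∘ (chartAt (EuclideanSpace ℝ (Fin m)) x₀).symm) z}) := by
    ext x
    simp only [Set.mem_ofPred_eq, Set.mem_iUnion, Set.mem_image, Set.mem_preimage, Subtype.exists,
      exists_and_right, exists_eq_right]
    constructor
    · intro hx
      have : x ∈ ⋃ x₀ ∈ F, (chartAt (EuclideanSpace ℝ (Fin m)) x₀).source := hF ▸ Set.mem_univ x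
      obtain ⟨x₀, h₀, hxs⟩ := Set.mem_iUnion₂.1 this
      exact ⟨x₀, h₀, hxs, (mdifferentiableAt_iff_comp_symm (chart_mem_atlas _ x₀) hxs).1 hx⟩
    · rintro ⟨x₀, h₀, hxs, hd⟩
      exact (mdifferentiableAt_iff_comp_symm (chart_mem_atlas _ x₀) hxs).2 hd
  rw [key]
  refine Finset.measurableSet_biUnion F fun x₀ _ => ?_
  refine MeasurableSet.subtype_image
    (chartAt (EuclideanSpace ℝ (Fin m)) x₀).open_source.measurableSet ?_
  have hcont := continuousOn_iff_continuous_domRestrict.1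
    (chartAt (EuclideanSpace ℝ (Fin m)) x₀).continuousOn
  exact hcont.measurable (measurableSet_of_differentiableAt ℝ _)

/-- Rademacher's theorem on a compact manifold. -/
lemma ae_mdifferentiableAt_of_locallyLipschitz [IsManifold (𝓡 m) 1 M] [CompactSpace M]
    [MeasurableSpace M] [BorelSpace M] {φ : M → ℝ}
    (hφ : ∀ e ∈ atlas (EuclideanSpace ℝ (Fin m)) M, ∀ z ∈ e.target, ∃ U ∈ 𝓝 z, ∃ K,
      LipschitzOnWith K (φ ∘ e.symm) U) {μ : Measure M} (hμ : AbsContLebesgue m μ) :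
    ∀ᵐ x ∂μ, MDifferentiableAt (𝓡 m) 𝓘(ℝ, ℝ) φ x := by
  refine hμ _ (measurableSet_mdifferentiableAt φ).compl fun e he => ?_
  refine measure_null_of_locally_null _ ?_
  rintro _ ⟨x, ⟨-, hx⟩, rfl⟩
  obtain ⟨U, hU, K, hK⟩ := hφ e he (e x) (e.map_source hx)
  obtain ⟨V, hVU, hV, hxV⟩ := mem_nhds_iff.1 hU
  refine ⟨V ∩ e '' ({x | ¬ MDifferentiableAt (𝓡 m) 𝓘(ℝ, ℝ) φ x} ∩ e.source), ?_, ?_⟩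
  · exact Filter.inter_mem (mem_nhdsWithin_of_mem_nhds (hV.mem_nhds hxV)) self_mem_nhdsWithin
  · have := (hK.mono hVU).ae_differentiableWithinAt_of_mem (μ := volume)
    refine measure_mono_null ?_ this
    rintro _ ⟨hzV, w, ⟨hw, hws⟩, rfl⟩ hd
    exact hw ((mdifferentiableAt_iff_comp_symm he hws).2
      ((hd hzV).differentiableAt (hV.mem_nhds hzV)))

/-- A `C¹` cost is locally Lipschitz in charts of `M`, uniformly on the compact manifold `N`. -/
lemma exists_lipschitzOnWith_uniform [IsManifold (𝓡 m) 1 M] [IsManifold (𝓡 n) 1 N]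
    [CompactSpace N] {c : M × N → ℝ} (hc : ContMDiff ((𝓡 m).prod (𝓡 n)) 𝓘(ℝ, ℝ) 1 c)
    {e : OpenPartialHomeomorph M (EuclideanSpace ℝ (Fin m))}
    (he : e ∈ atlas (EuclideanSpace ℝ (Fin m)) M) {z : EuclideanSpace ℝ (Fin m)}
    (hz : z ∈ e.target) :
    ∃ U ∈ 𝓝 z, ∃ K, ∀ y, LipschitzOnWith K (fun z => c (e.symm z, y)) U := by
  have loc : ∀ y₀ : N, ∃ V ∈ 𝓝 y₀, ∃ U ∈ 𝓝 z, ∃ K, ∀ y ∈ V,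
      LipschitzOnWith K (fun z => c (e.symm z, y)) U := by
    intro y₀
    let e' := chartAt (EuclideanSpace ℝ (Fin n)) y₀
    have hy₀ : y₀ ∈ e'.source := mem_chart_source _ y₀
    have h1 : ContMDiffAt 𝓘(ℝ, EuclideanSpace ℝ (Fin m) × EuclideanSpace ℝ (Fin n)) (𝓡 m) 1
        (fun p : EuclideanSpace ℝ (Fin m) × EuclideanSpace ℝ (Fin n) => e.symm p.1)
        (z, e' y₀) :=
      ContMDiffAt.comp (z, e' y₀) (contMDiffAt_symm_of_mem_maximalAtlas
        (IsManifold.subset_maximalAtlas he) hz) contDiff_fst.contMDiff.contMDiffAt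
    have h2 : ContMDiffAt 𝓘(ℝ, EuclideanSpace ℝ (Fin m) × EuclideanSpace ℝ (Fin n)) (𝓡 n) 1
        (fun p : EuclideanSpace ℝ (Fin m) × EuclideanSpace ℝ (Fin n) => e'.symm p.2)
        (z, e' y₀) :=
      ContMDiffAt.comp (z, e' y₀) (contMDiffAt_symm_of_mem_maximalAtlas
        (IsManifold.chart_mem_maximalAtlas y₀) (e'.map_source hy₀))
        contDiff_snd.contMDiff.contMDiffAt
    have h3 := (hc.contMDiffAt (x := (e.symm z, e'.symm (e' y₀)))).comp (z, e' y₀)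
      (h1.prodMk h2)
    obtain ⟨K, t, ht, hK⟩ := h3.contDiffAt.exists_lipschitzOnWith
    obtain ⟨U, hU, W, hW, hUW⟩ := mem_nhds_prod_iff.1 ht
    refine ⟨e'.source ∩ e' ⁻¹' W, Filter.inter_mem (e'.open_source.mem_nhds hy₀)
      ((e'.continuousAt hy₀).preimage_mem_nhds hW), U, hU, K, ?_⟩
    rintro y ⟨hys, hyW⟩ a ha b hb
    have := hK (hUW (Set.mk_mem_prod ha hyW)) (hUW (Set.mk_mem_prod hb hyW))
    simpa [e'.left_inv hys, Prod.edist_eq] using this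
  -- The neighbourhood and the constant depend on `y₀`; by compactness of `N`, finitely many of them
  -- suffice.
  choose V hV U hU K hK using loc
  obtain ⟨F, hF⟩ := CompactSpace.elim_nhds_subcover V hV
  refine ⟨⋂ y₀ ∈ F, U y₀, (Filter.biInter_finset_mem F).2 fun y₀ _ => hU y₀, F.sup K,
    fun y => ?_⟩
  have hy : y ∈ ⋃ y₀ ∈ F, V y₀ := hF ▸ Set.mem_univ y
  obtain ⟨y₀, h₀, hyV⟩ := Set.mem_iUnion₂.1 hy
  exact ((hK y₀ y hyV).weaken (Finset.le_sup h₀)).mono (Set.biInter_subset_of_mem h₀)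

/-- A function with the moduli of continuity of a `C¹` cost is differentiable almost
everywhere. -/
lemma ae_mdifferentiableAt_of_modulus [IsManifold (𝓡 m) 1 M] [CompactSpace M]
    [MeasurableSpace M] [BorelSpace M] [IsManifold (𝓡 n) 1 N] [CompactSpace N]
    {c : M × N → ℝ} (hc : ContMDiff ((𝓡 m).prod (𝓡 n)) 𝓘(ℝ, ℝ) 1 c) {φ : M → ℝ}
    (hφ : ∀ x x' K, (∀ y, c (x, y) ≤ c (x', y) + K) → φ x ≤ φ x' + K)
    {μ : Measure M} (hμ : AbsContLebesgue m μ) :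
    ∀ᵐ x ∂μ, MDifferentiableAt (𝓡 m) 𝓘(ℝ, ℝ) φ x := by
  refine ae_mdifferentiableAt_of_locallyLipschitz (fun e he z hz => ?_) hμ
  obtain ⟨U, hU, K, hK⟩ := exists_lipschitzOnWith_uniform hc he hz
  exact ⟨U, hU, K, LipschitzOnWith.of_le_add_mul _ fun a ha b hb =>
    hφ _ _ _ fun y => (hK y).le_add_mul ha hb⟩

lemma mfderiv_eq_fderiv_comp_symm {f : M → ℝ} {x : M}
    (hf : MDifferentiableAt (𝓡 m) 𝓘(ℝ, ℝ) f x) :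
    mfderiv (𝓡 m) 𝓘(ℝ, ℝ) f x =
      fderiv ℝ (f ∘ (chartAt (EuclideanSpace ℝ (Fin m)) x).symm)
        (chartAt (EuclideanSpace ℝ (Fin m)) x x) := by
  refine hf.mfderiv.trans ?_
  simp [writtenInExtChartAt]
  rfl

/-- At a contact point of `φ + ψ ≤ c`, the differentials of `φ` and of `c (·, y)` coincide. -/
lemma partialX_eq_mfderiv [IsManifold (𝓡 m) 1 M] {c : M × N → ℝ}
    (hc : ContMDiff ((𝓡 m).prod (𝓡 n)) 𝓘(ℝ, ℝ) 1 c) {φ : M → ℝ} {x : M} {y : N} {a : ℝ}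
    (hφ : MDifferentiableAt (𝓡 m) 𝓘(ℝ, ℝ) φ x)
    (hle : ∀ x', φ x' + a ≤ c (x', y)) (heq : φ x + a = c (x, y)) :
    partialX (m := m) c x y = mfderiv (𝓡 m) 𝓘(ℝ, ℝ) φ x := by
  have hcx : MDifferentiableAt (𝓡 m) 𝓘(ℝ, ℝ) (fun x' => c (x', y)) x :=
    (hc.comp (contMDiff_id.prodMk contMDiff_const)).contMDiffAt.mdifferentiableAt one_ne_zero
  rw [partialX, mfderiv_eq_fderiv_comp_symm hcx, mfderiv_eq_fderiv_comp_symm hφ]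
  set e := chartAt (EuclideanSpace ℝ (Fin m)) x
  have hx : x ∈ e.source := mem_chart_source _ x
  have he := chart_mem_atlas (EuclideanSpace ℝ (Fin m)) x
  have d1 := (mdifferentiableAt_iff_comp_symm he hx).1 hcx
  have d2 := (mdifferentiableAt_iff_comp_symm he hx).1 hφ
  -- At a contact point, `c (·, y) - φ` attains its minimum value `a`.
  have hmin : IsLocalMin (((fun x' => c (x', y)) ∘ e.symm) - (φ ∘ e.symm)) (e x) := by
    refine Filter.Eventually.of_forall fun z => ?_
    simp only [Pi.sub_apply, Function.comp_apply, e.left_inv hx]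
    linarith [hle (e.symm z)]
  have := hmin.fderiv_eq_zero
  rw [fderiv_sub d1 d2] at this
  exact sub_eq_zero.1 this

end Differentiability

/-! ### Existence of optimal plans and inner approximation -/

section Existence

variable {M N : Type*}
  [TopologicalSpace M] [TopologicalSpace.MetrizableSpace M] [CompactSpace M]
  [MeasurableSpace M] [BorelSpace M]
  [TopologicalSpace N] [TopologicalSpace.MetrizableSpace N] [CompactSpace N]
  [MeasurableSpace N] [BorelSpace N]

/-- Direct method: both marginals are weakly continuous, so the plans form a closed subset of the
compact space of probability measures, and the cost is weakly continuous. -/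
lemma optimalPlans_nonempty [SecondCountableTopology M] {c : M × N → ℝ} (hc : Continuous c)
    (μ : Measure M) [IsProbabilityMeasure μ] (ν : Measure N) [IsProbabilityMeasure ν] :
    (optimalPlans c μ ν).Nonempty := by
  let K : Set (ProbabilityMeasure (M × N)) :=
    {γ | γ.map measurable_fst.aemeasurable = ⟨μ, inferInstance⟩ ∧
      γ.map measurable_snd.aemeasurable = ⟨ν, inferInstance⟩}
  have hK : ∀ γ : ProbabilityMeasure (M × N),
      γ ∈ K ↔ (γ : Measure (M × N)) ∈ transportPlans μ ν := by
    intro γ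
    exact and_congr Subtype.ext_iff Subtype.ext_iff
  have hKc : IsCompact K := IsClosed.isCompact <|
    (isClosed_eq (ProbabilityMeasure.continuous_map continuous_fst) continuous_const).inter
      (isClosed_eq (ProbabilityMeasure.continuous_map continuous_snd) continuous_const)
  have hKne : K.Nonempty := by
    refine ⟨⟨μ.prod ν, inferInstance⟩, (hK _).2 ⟨?_, ?_⟩⟩
    · simp [Measure.map_fst_prod]
    · simp [Measure.map_snd_prod]
  have hcont := ProbabilityMeasure.continuous_integral_continuousMap (X := M × N)
    (⟨c, hc⟩ : C(M × N, ℝ))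
  obtain ⟨γ, hγ, hmin⟩ := hKc.exists_isMinOn hKne hcont.continuousOn
  refine ⟨γ, (hK γ).1 hγ, fun γ' hγ' => ?_⟩
  have := isProbabilityMeasure_of_mem_transportPlans hγ'
  exact hmin ((hK ⟨γ', this⟩).2 hγ')

/-- Inner regularity turns a Borel set of full measure into a `σ`-compact one, to which pruning
applies. -/
lemma exists_isSigmaCompact_subset {Z : Type*} [TopologicalSpace Z]
    [TopologicalSpace.MetrizableSpace Z] [CompactSpace Z] [MeasurableSpace Z] [BorelSpace Z]
    (γ : Measure Z) [IsFiniteMeasure γ] {G : Set Z} (hG : MeasurableSet G) :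
    ∃ T ⊆ G, IsSigmaCompact T ∧ γ (G \ T) = 0 := by
  have h : ∀ k : ℕ, ∃ K ⊆ G, IsCompact K ∧ γ (G \ K) < ((k : ENNReal) + 1)⁻¹ := fun k =>
    hG.exists_isCompact_sdiff_lt (measure_ne_top _ _) (by simp)
  choose K hKG hK hlt using h
  refine ⟨⋃ k, K k, Set.iUnion_subset hKG, ⟨K, hK, rfl⟩, ?_⟩
  refine le_antisymm (ENNReal.le_of_forall_pos_le_add fun ε hε _ => ?_) zero_le
  obtain ⟨k, hk⟩ := ENNReal.exists_inv_nat_lt (ENNReal.coe_pos.2 hε).ne'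
  calc γ (G \ ⋃ k, K k) ≤ γ (G \ K k) :=
        measure_mono (Set.sdiff_subset_sdiff_right (Set.subset_iUnion K k))
    _ ≤ ((k : ENNReal) + 1)⁻¹ := (hlt k).le
    _ ≤ (k : ENNReal)⁻¹ := ENNReal.inv_le_inv.2 le_self_add
    _ ≤ 0 + ε := by rw [zero_add]; exact hk.le

end Existence

/-! ### From alternating paths to chains, and uniqueness -/

section Uniqueness

variable {m n : ℕ} {M N : Type*}
  [TopologicalSpace M] [ChartedSpace (EuclideanSpace ℝ (Fin m)) M]
  [TopologicalSpace N] [ChartedSpace (EuclideanSpace ℝ (Fin n)) N]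

/-- A long alternating path inside the contact set of a pair of potentials, over points of
differentiability of the potentials, is a chain. -/
lemma isAlternantChain_of_path [IsManifold (𝓡 m) 1 M] [IsManifold (𝓡 n) 1 N]
    {c : M × N → ℝ} (hc : ContMDiff ((𝓡 m).prod (𝓡 n)) 𝓘(ℝ, ℝ) 1 c) {φ : M → ℝ} {ψ : N → ℝ}
    (hle : ∀ z, φ z.1 + ψ z.2 ≤ c z) {Γ S T : Set (M × N)} (hΓ : CCyclicallyMonotone c Γ)
    (heq : ∀ z ∈ T, φ z.1 + ψ z.2 = c z) (hTΓ : T ⊆ Γ) (hTS : T ⊆ S)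
    (hφ : ∀ z ∈ T, MDifferentiableAt (𝓡 m) 𝓘(ℝ, ℝ) φ z.1)
    (hψ : ∀ z ∈ T, MDifferentiableAt (𝓡 n) 𝓘(ℝ, ℝ) ψ z.2)
    {k : ℕ} {b : Bool} {p : ℕ → M × N} (hp : ∀ l ≤ k, p l ∈ T)
    (hadj : ∀ l < k, Adjacent (xor b l.bodd) (p l) (p (l + 1))) :
    IsAlternantChain m n c S (k + 1) (fun l => (p (l - 1)).1) (fun l => (p (l - 1)).2) := by
  have hX : ∀ z ∈ T, partialX (m := m) c z.1 z.2 = mfderiv (𝓡 m) 𝓘(ℝ, ℝ) φ z.1 := fun z hz =>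
    partialX_eq_mfderiv hc (hφ z hz) (fun x' => hle (x', z.2)) (heq z hz)
  have hc' : ContMDiff ((𝓡 n).prod (𝓡 m)) 𝓘(ℝ, ℝ) 1 (fun w : N × M => c (w.2, w.1)) :=
    hc.comp (contMDiff_snd.prodMk contMDiff_fst)
  have hY : ∀ z ∈ T, partialY (n := n) c z.1 z.2 = mfderiv (𝓡 n) 𝓘(ℝ, ℝ) ψ z.2 := fun z hz =>
    partialX_eq_mfderiv (x := z.2) (y := z.1) (a := φ z.1) hc' (hψ z hz)
      (fun y' => by rw [add_comm]; exact hle (z.1, y')) (by rw [add_comm]; exact heq z hz)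
  have hXX : ∀ z ∈ T, ∀ w ∈ T, w.1 = z.1 →
      partialX (m := m) c z.1 z.2 = partialX (m := m) c z.1 w.2 := by
    rintro ⟨x, y⟩ hz ⟨x', y'⟩ hw (rfl : x' = x)
    exact (hX _ hz).trans (hX _ hw).symm
  have hYY : ∀ z ∈ T, ∀ w ∈ T, w.2 = z.2 →
      partialY (n := n) c z.1 z.2 = partialY (n := n) c w.1 z.2 := by
    rintro ⟨x, y⟩ hz ⟨x', y'⟩ hw (rfl : y' = y)
    exact (hY _ hz).trans (hY _ hw).symm
  have hpT : ∀ l ∈ Set.Icc 1 (k + 1), p (l - 1) ∈ T := fun l hl =>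
    hp _ (by have := hl.2; omega)
  refine ⟨by omega, fun l hl => hTS (hpT l hl), ?_, ?_⟩
  · intro I hI x y hmem hx
    refine hΓ I hI x y (fun i hi => ?_) hx
    obtain ⟨l, hl, hli⟩ := hmem i hi
    exact hli ▸ hTΓ (hpT l hl)
  · intro l hl1 hlk
    obtain ⟨j, rfl⟩ : ∃ j, l = j + 1 := ⟨l - 1, by omega⟩
    have h0 := hp j (by omega)
    have h1 := hp (j + 1) (by omega)
    have hj := hadj j (by omega)
    -- The chain is indexed from 1 and the path from 0. At the last step the minimum truncates, and
    -- the condition on the point after next becomes trivial.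
    have hmin : min (k + 1) (j + 1 + 2) - 1 = if j + 1 < k then j + 2 else j + 1 := by
      split_ifs <;> omega
    have hnext : j + 1 < k → Adjacent (!(xor b j.bodd)) (p (j + 1)) (p (j + 2)) := fun h => by
      simpa [Nat.bodd_succ] using hadj (j + 1) h
    cases hb : (xor b j.bodd) with
    | true =>
      rw [hb] at hj hnext
      refine Or.inl ⟨hj.2.symm, fun h => hj.1 (Prod.ext hj.2 h.symm), ?_, hXX _ h0 _ h1 hj.2⟩
      simp only [hmin]
      split_ifs with h
      · exact (hnext h).2.symm
      · rfl
    | false =>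
      rw [hb] at hj hnext
      refine Or.inr ⟨hj.2.symm, fun h => hj.1 (Prod.ext h.symm hj.2), ?_, hYY _ h0 _ h1 hj.2⟩
      simp only [hmin]
      split_ifs with h
      · exact (hnext h).2.symm
      · rfl

variable [MeasurableSpace M] [MeasurableSpace N]

lemma measure_chainLimitSet_eq_zero {c : M × N → ℝ} {S : Set (M × N)} {μ : Measure M}
    {ν : Measure N} {γ : Measure (M × N)} (hγ : γ ∈ transportPlans μ ν)
    (hrare : μ (Prod.fst '' chainLimitSet m n c S) = 0 ∨
      ν (Prod.snd '' chainLimitSet m n c S) = 0) :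
    γ (chainLimitSet m n c S) = 0 := by
  rcases hrare with h | h
  · rw [← hγ.1] at h
    exact measure_mono_null (Set.subset_preimage_image _ _)
      (Measure.preimage_null_of_map_null measurable_fst.aemeasurable h)
  · rw [← hγ.2] at h
    exact measure_mono_null (Set.subset_preimage_image _ _)
      (Measure.preimage_null_of_map_null measurable_snd.aemeasurable h)

variable [CompactSpace M] [BorelSpace M] [CompactSpace N] [BorelSpace N]

/-- Both plans are carried by any set that carries their midpoint, so one pair of potentials serves
them both. -/
lemma midpoint_mem_optimalPlans [TopologicalSpace.MetrizableSpace M]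
    [TopologicalSpace.MetrizableSpace N] [SecondCountableTopology M] {c : M × N → ℝ}
    (hc : Continuous c) {μ : Measure M} [IsProbabilityMeasure μ] {ν : Measure N}
    {γ₁ γ₂ : Measure (M × N)} (h₁ : γ₁ ∈ optimalPlans c μ ν) (h₂ : γ₂ ∈ optimalPlans c μ ν) :
    (2⁻¹ : ENNReal) • (γ₁ + γ₂) ∈ optimalPlans c μ ν := by
  have := isProbabilityMeasure_of_mem_transportPlans h₁.1
  have := isProbabilityMeasure_of_mem_transportPlans h₂.1
  refine ⟨⟨?_, ?_⟩, fun γ' hγ' => ?_⟩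
  · rw [Measure.map_smul, Measure.map_add _ _ measurable_fst, h₁.1.1, h₂.1.1]
    rw [← two_smul ENNReal μ, smul_smul, ENNReal.inv_mul_cancel (by simp) (by simp), one_smul]
  · rw [Measure.map_smul, Measure.map_add _ _ measurable_snd, h₁.1.2, h₂.1.2]
    rw [← two_smul ENNReal ν, smul_smul, ENNReal.inv_mul_cancel (by simp) (by simp), one_smul]
  · rw [integral_smul_measure, integral_add_measure
      (integrable_of_continuous_of_compactSpace hc _)
      (integrable_of_continuous_of_compactSpace hc _)]
    have e₁ := h₁.2 γ' hγ'
    have e₂ := h₂.2 γ' hγ'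
    simp only [ENNReal.toReal_inv, ENNReal.toReal_ofNat, smul_eq_mul]
    linarith

/-- Uniqueness of the optimal plan, if the points of arbitrarily long chains are negligible for
all optimal plans. -/
lemma optimalPlans_subsingleton [T2Space M] [T2Space N] [IsManifold (𝓡 m) 1 M]
    [IsManifold (𝓡 n) 1 N]
    {c : M × N → ℝ} (hc : ContMDiff ((𝓡 m).prod (𝓡 n)) 𝓘(ℝ, ℝ) 1 c)
    {μ : Measure M} [IsProbabilityMeasure μ] (hμ : AbsContLebesgue m μ)
    {ν : Measure N} (hν : AbsContLebesgue n ν)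
    {E₀ : Set (M × N)} (hE₀ : IsSigmaCompact E₀) (hE₀_null : ∀ γ ∈ optimalPlans c μ ν, γ E₀ = 0)
    (hnull : ∀ γ ∈ optimalPlans c μ ν, γ (chainLimitSet m n c E₀ᶜ) = 0) :
    (optimalPlans c μ ν).Subsingleton := by
  intro γ₁ h₁ γ₂ h₂
  have := ChartedSpace.secondCountable_of_sigmaCompact (EuclideanSpace ℝ (Fin m)) M
  have := ChartedSpace.secondCountable_of_sigmaCompact (EuclideanSpace ℝ (Fin n)) N
  have : TopologicalSpace.MetrizableSpace M := inferInstance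
  have : TopologicalSpace.MetrizableSpace N := inferInstance
  have : PolishSpace M := by
    let := TopologicalSpace.metrizableSpaceMetric M
    infer_instance
  have : PolishSpace N := by
    let := TopologicalSpace.metrizableSpaceMetric N
    infer_instance
  have hcc := hc.continuous
  have := isProbabilityMeasure_of_mem_transportPlans h₁.1
  have := isProbabilityMeasure_of_mem_transportPlans h₂.1
  have hγ := midpoint_mem_optimalPlans hcc h₁ h₂
  set γ := (2⁻¹ : ENNReal) • (γ₁ + γ₂) with hγdef
  have := isProbabilityMeasure_of_mem_transportPlans hγ.1
  have hΓ := cCyclicallyMonotone_support hcc hγ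
  have hne : γ.support.Nonempty := by
    by_contra h
    have h0 := Measure.measure_compl_support (μ := γ)
    rw [Set.not_nonempty_iff_eq_empty.1 h, Set.compl_empty, measure_univ] at h0
    exact one_ne_zero h0
  obtain ⟨C, hC⟩ := isCompact_univ.exists_bound_of_continuousOn hcc.continuousOn
  obtain ⟨φ, ψ, hle, heq, hφ, hψ⟩ := hΓ.exists_potentials (fun z => hC z (Set.mem_univ z)) hne
  have hc' : ContMDiff ((𝓡 n).prod (𝓡 m)) 𝓘(ℝ, ℝ) 1 (fun w : N × M => c (w.2, w.1)) :=
    hc.comp (contMDiff_snd.prodMk contMDiff_fst)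
  have aeφ : ∀ᵐ z ∂γ, MDifferentiableAt (𝓡 m) 𝓘(ℝ, ℝ) φ z.1 := by
    have := ae_mdifferentiableAt_of_modulus hc hφ hμ
    rw [← hγ.1.1] at this
    exact ae_of_ae_map measurable_fst.aemeasurable this
  have aeψ : ∀ᵐ z ∂γ, MDifferentiableAt (𝓡 n) 𝓘(ℝ, ℝ) ψ z.2 := by
    have := ae_mdifferentiableAt_of_modulus hc' hψ hν
    rw [← hγ.1.2] at this
    exact ae_of_ae_map measurable_snd.aemeasurable this
  -- A measurable hull is removed because `E_∞` need not be Borel.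
  let G : Set (M × N) := γ.support ∩ {z | MDifferentiableAt (𝓡 m) 𝓘(ℝ, ℝ) φ z.1} ∩
    {z | MDifferentiableAt (𝓡 n) 𝓘(ℝ, ℝ) ψ z.2} ∩ E₀ᶜ ∩
      (toMeasurable γ (chainLimitSet m n c E₀ᶜ))ᶜ
  have hG : MeasurableSet G :=
    (((Measure.isClosed_support.measurableSet.inter
      (measurable_fst (measurableSet_mdifferentiableAt φ))).inter
      (measurable_snd (measurableSet_mdifferentiableAt ψ))).inter
      (measurableSet_of_isSigmaCompact hE₀).compl).inter (measurableSet_toMeasurable _ _).compl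
  have hGae : ∀ᵐ z ∂γ, z ∈ G := by
    filter_upwards [Measure.support_mem_ae (μ := γ), aeφ, aeψ,
      measure_eq_zero_iff_ae_notMem.1 (hE₀_null γ hγ), measure_eq_zero_iff_ae_notMem.1
        ((measure_toMeasurable _).trans (hnull γ hγ))] with z h1 h2 h3 h4 h5
    exact ⟨⟨⟨⟨h1, h2⟩, h3⟩, h4⟩, h5⟩
  obtain ⟨T, hTG, hTc, hT0⟩ := exists_isSigmaCompact_subset γ hG
  have hT : γ Tᶜ = 0 := by
    refine measure_mono_null (t := Gᶜ ∪ (G \ T)) (fun z hz => ?_)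
      (measure_union_null (ae_iff.1 hGae) hT0)
    by_cases hzG : z ∈ G
    · exact Or.inr ⟨hzG, hz⟩
    · exact Or.inl hzG
  have hT12 : γ₁ Tᶜ = 0 ∧ γ₂ Tᶜ = 0 := by
    rw [hγdef, Measure.smul_apply, Measure.add_apply, smul_eq_mul, mul_eq_zero] at hT
    simpa using hT
  refine measure_eq_of_iInter_iterate_prune_eq_empty hTc ?_ hT12.1 hT12.2
    (h₁.1.1.trans h₂.1.1.symm) (h₁.1.2.trans h₂.1.2.symm)
  refine Set.eq_empty_iff_forall_notMem.2 fun z hz => ?_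
  rw [Set.mem_iInter] at hz
  refine (hTG (hz 0)).2 (subset_toMeasurable _ _ fun K => ?_)
  -- The kind of the first move is immaterial; `z` is the first of the `K + 1` points of the chain.
  obtain ⟨p, hp0, hp, hadj⟩ := exists_path_of_mem_iterate_prune K z (hz K) true
  exact ⟨K + 1, by omega, _, _, isAlternantChain_of_path hc hle hΓ
    (fun w hw => heq w (hTG hw).1.1.1.1) (fun w hw => (hTG hw).1.1.1.1)
    (fun w hw => (hTG hw).1.2) (fun w hw => (hTG hw).1.1.1.2) (fun w hw => (hTG hw).1.1.2)
    hp hadj, 1, ⟨le_rfl, by omega⟩, hp0⟩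

end Uniqueness

end OptTransport

theorem corollary1p4 {m n : ℕ} {M N : Type*}
    [TopologicalSpace M] [T2Space M] [CompactSpace M]
    [ChartedSpace (EuclideanSpace ℝ (Fin m)) M] [IsManifold (𝓡 m) ∞ M]
    [MeasurableSpace M] [BorelSpace M]
    [TopologicalSpace N] [T2Space N] [CompactSpace N]
    [ChartedSpace (EuclideanSpace ℝ (Fin n)) N] [IsManifold (𝓡 n) ∞ N]
    [MeasurableSpace N] [BorelSpace N]
    (c : M × N → ℝ) (hc : ContMDiff ((𝓡 m).prod (𝓡 n)) 𝓘(ℝ, ℝ) 1 c)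
    (μ : Measure M) [IsProbabilityMeasure μ] (hμ : OptTransport.AbsContLebesgue m μ)
    (ν : Measure N) [IsProbabilityMeasure ν] (hν : OptTransport.AbsContLebesgue n ν)
    (E₀ : Set (M × N)) (hE₀ : IsSigmaCompact E₀)
    (hE₀_null : ∀ γ ∈ OptTransport.optimalPlans c μ ν, γ E₀ = 0)
    (hrare : μ (Prod.fst '' OptTransport.chainLimitSet m n c E₀ᶜ) = 0 ∨
      ν (Prod.snd '' OptTransport.chainLimitSet m n c E₀ᶜ) = 0) :
    (∀ γ ∈ OptTransport.optimalPlans c μ ν, γ (OptTransport.chainLimitSet m n c E₀ᶜ) = 0) ∧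
      ∃ γ, OptTransport.optimalPlans c μ ν = {γ} := by
  have hMman : IsManifold (𝓡 m) 1 M := IsManifold.of_le (n := ∞) (by simp)
  have hNman : IsManifold (𝓡 n) 1 N := IsManifold.of_le (n := ∞) (by simp)
  have := ChartedSpace.secondCountable_of_sigmaCompact (EuclideanSpace ℝ (Fin m)) M
  have := ChartedSpace.secondCountable_of_sigmaCompact (EuclideanSpace ℝ (Fin n)) N
  have hnull : ∀ γ ∈ OptTransport.optimalPlans c μ ν,
      γ (OptTransport.chainLimitSet m n c E₀ᶜ) = 0 :=
    fun γ hγ => OptTransport.measure_chainLimitSet_eq_zero hγ.1 hrare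
  refine ⟨hnull, ?_⟩
  obtain ⟨γ₁, h₁⟩ := OptTransport.optimalPlans_nonempty hc.continuous μ ν
  refine ⟨γ₁, Set.eq_singleton_iff_unique_mem.2 ⟨h₁, fun γ₂ h₂ => ?_⟩⟩
  exact OptTransport.optimalPlans_subsingleton hc hμ hν hE₀ hE₀_null hnull h₂ h₁
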